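/- Let $f:\mathbb{R}^n\to\mathbb{R}$ be twice continuously differentiable and bounded below, and let $\|\cdot\|$ be the Euclidean vector norm and the spectral matrix norm. For a symmetric matrix $B_k$ and $\sigma_k>0$ put $$T_2(x_k,s)=f(x_k)+\nabla f(x_k)^Ts+\tfrac12 s^TB_ks,\qquad m(x_k,s,\sigma_k)=T_2(x_k,s)+\tfrac{\sigma_k}{3}\|s\|^3,\qquad \rho_k=\frac{f(x_k)-f(x_k+s_k)}{T_2(x_k,0)-T_2(x_k,s_k)}.$$ **Algorithm (ARC with dynamic Hessian accuracy).** Constants: $0<\theta<1$, $\alpha\in[0,\tfrac23)$, $0<\sigma_{\min}\le\sigma_0$, $0<\eta_1\le\eta_2<\tfrac{2-3\alpha}{2}$, $0<\gamma_1<1<\gamma_2<\gamma_3$, $C>0$. Start from $x_0,\sigma_0$ with $C_0=C$ and flag $=1$. At iteration $k$: 1. $B_k$ is a symmetric matrix with $\|\nabla^2f(x_k)-B_k\|\le C_k$, and $s_k$ is a step with $m(x_k,s_k,\sigma_k)<m(x_k,0,\sigma_k)$ and $\|\nabla_sm(x_k,s_k,\sigma_k)\|\le\theta_k\|\nabla f(x_k)\|$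 for some $0\le\theta_k\le\theta$. 2. If $\|s_k\|<1$, flag $=1$ and $C>\alpha(1-\theta)\|\nabla f(x_k)\|$, the iteration is unsuccessful: $x_{k+1}=x_k$, $\sigma_{k+1}=\sigma_k$, $C_{k+1}=\alpha(1-\theta)\|\nabla f(x_k)\|$, flag $:=0$, and a new matrix $B_{k+1}$ is computed. 3. Otherwise, if $\rho_k\ge\eta_1$, the iteration is successful (very successful if $\rho_k\ge\eta_2$): $x_{k+1}=x_k+s_k$; $\sigma_{k+1}\in[\max(\sigma_{\min},\gamma_1\sigma_k),\sigma_k]$ if $\rho_k\ge\eta_2$, and $\sigma_{k+1}\in[\sigma_k,\gamma_2\sigma_k]$ if $\rho_k<\eta_2$; if $\|s_k\|\ge1$ then $C_{k+1}=C$ and flag $:=1$, else $C_{k+1}=\alpha(1-\theta)\|\nabla f(x_{k+1})\|$ and flag $:=0$; a new matrix $B_{k+1}$ is computed. 4. Otherwise the iteration is unsuccessful: $x_{k+1}=x_k$, $\sigma_{k+1}\in[\gamma_2\sigma_k,\gamma_3\sigma_k]$, and $C_{k+1}=C_k$, $B_{k+1}=B_k$, and the flag is unchanged. Consider an infinite run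 of this algorithm (no stopping test). Assume that there are constants $L$ and $\kappa_B$ with $$\|\nabla^2f(x_k+\beta s_k)-\nabla^2f(x_k)\|\le L\beta\|s_k\|,\qquad \|B_k\|\le\kappa_B\qquad\text{for all }k\ge0,\ \beta\in[0,1],$$ and that one of the following holds: - (a) $\|\nabla_sm(x_k,s_k,\sigma_k)\|\le\theta\min(\|s_k\|^2,\|\nabla f(x_k)\|)$ for all $k$; or - (b) $\|\nabla_sm(x_k,s_k,\sigma_k)\|\le\theta\min(1,\|s_k\|)\|\nabla f(x_k)\|$ for all $k$, and $\|\nabla^2f(x_k+\beta s_k)\|\le\kappa_H$ for some $\kappa_H$ and all $k$ and $\beta\in[0,1]$. **Theorem.** Let $k_0<k_1<\dots$ be indices of successful iterations such that $x_{k_i}\to x^*$ as $i\to\infty$ and $B_{k_i}$ is positive definite for all sufficiently large $i$. Then $x^*$ is second-order critical, that is, $\nabla f(x^*)=0$ and $\nabla^2f(x^*)$ is positive semidefinite. Suppose further that the positive definiteness is uniform: for some $\lambda>0$, $\lambda_{\min}(B_{k_i})\ge\lambda$ for all sufficiently large $i$. Then: - i) $x_k\to x^*$ as $k\to\infty$ for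 the whole sequence. - ii) If, in addition, $m(x_k,s_k,\sigma_k)\le m(x_k,s_k^C,\sigma_k)$ for all $k\ge0$, where $s_k^C=-\alpha_k^C\nabla f(x_k)$ with $\alpha_k^C\in\arg\min_{a\ge0}m(x_k,-a\nabla f(x_k),\sigma_k)$ is the Cauchy step, then all iterations are eventually very successful and $x_k\to x^*$ q-quadratically: there is a constant $c$ such that $\|x_{k+1}-x^*\|\le c\|x_k-x^*\|^2$ for all sufficiently large $k$. -/

import Mathlib

open Filter Topology
open scoped Gradient RealInnerProductSpace

noncomputable section

namespace ARC

/-- The Euclidean space of dimension `n`. Symmetric `n × n` matrices are represented by self-adjoint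
operators on it; the Euclidean (spectral) matrix norm is the operator norm. -/
abbrev Vec (n : ℕ) := EuclideanSpace ℝ (Fin n)

variable {n : ℕ}

/-- The Hessian of `f` at `x`, i.e. the derivative of the gradient field. -/
def hessian (f : Vec n → ℝ) (x : Vec n) : Vec n →L[ℝ] Vec n :=
  fderiv ℝ (fun y => ∇ f y) x

/-- The quadratic model `T₂(x, s) = f(x) + ∇f(x)ᵀ s + ½ sᵀ B s`. -/
def quadModel (f : Vec n → ℝ) (B : Vec n →L[ℝ] Vec n) (x s : Vec n) : ℝ :=
  f x + ⟪∇ f x, s⟫ + 1 / 2 * ⟪s, B s⟫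

/-- The cubic model `m(x, s, σ) = T₂(x, s) + (σ / 3) ‖s‖³`. -/
def cubicModel (f : Vec n → ℝ) (B : Vec n →L[ℝ] Vec n) (x s : Vec n) (σ : ℝ) : ℝ :=
  quadModel f B x s + σ / 3 * ‖s‖ ^ 3

/-- The constants of the algorithm, with the ranges prescribed for them. -/
structure Params where
  θ : ℝ
  α : ℝ
  η₁ : ℝ
  η₂ : ℝ
  γ₁ : ℝ
  γ₂ : ℝ
  γ₃ : ℝ
  σmin : ℝ
  C : ℝ
  θ_pos : 0 < θ
  θ_lt : θ < 1
  α_nonneg : 0 ≤ α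
  α_lt : α < 2 / 3
  σmin_pos : 0 < σmin
  η₁_pos : 0 < η₁
  η₁_le : η₁ ≤ η₂
  η₂_lt : η₂ < (2 - 3 * α) / 2
  γ₁_pos : 0 < γ₁
  γ₁_lt : γ₁ < 1
  γ₂_gt : 1 < γ₂
  γ₃_gt : γ₂ < γ₃
  C_pos : 0 < C

/-- The data produced by an infinite run: at iteration `k`, the iterate `x k`, the Hessian
approximation `B k`, the trial step `s k`, the regularization parameter `σ k`, the accuracy level
`acc k` required of `B k` (written `C_k` on paper) and the flag. -/
structure Trajectory (n : ℕ) where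
  x : ℕ → Vec n
  s : ℕ → Vec n
  B : ℕ → Vec n →L[ℝ] Vec n
  σ : ℕ → ℝ
  acc : ℕ → ℝ
  flag : ℕ → Bool

namespace Trajectory

variable (f : Vec n → ℝ) (p : Params) (t : Trajectory n)

/-- The cubic model of iteration `k` as a function of the step. -/
def model (k : ℕ) (s : Vec n) : ℝ := cubicModel f (t.B k) (t.x k) s (t.σ k)

/-- The ratio `ρ_k` of the actual to the predicted reduction (without the cubic term). -/
def ratio (k : ℕ) : ℝ :=
  (f (t.x k) - f (t.x k + t.s k)) /
    (quadModel f (t.B k) (t.x k) 0 - quadModel f (t.B k) (t.x k) (t.s k))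

/-- Iteration `k` is unsuccessful because of the check on the length of the step: the step is short
but `B k` was only computed with the coarse accuracy `C`. -/
def ShortStepRejected (k : ℕ) : Prop :=
  ‖t.s k‖ < 1 ∧ t.flag k = true ∧ p.α * (1 - p.θ) * ‖∇ f (t.x k)‖ < p.C

/-- Iteration `k` is successful: the trial step is accepted (this includes the very successful
iterations). -/
def Successful (k : ℕ) : Prop :=
  ¬ t.ShortStepRejected f p k ∧ p.η₁ ≤ t.ratio f k

/-- Iteration `k` is very successful. -/
def VerySuccessful (k : ℕ) : Prop :=
  ¬ t.ShortStepRejected f p k ∧ p.η₂ ≤ t.ratio f k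

/-- Iteration `k` is unsuccessful because of a small ratio `ρ_k`. -/
def RatioRejected (k : ℕ) : Prop :=
  ¬ t.ShortStepRejected f p k ∧ t.ratio f k < p.η₁

/-- `t` is an infinite run of the ARC algorithm with dynamic Hessian accuracy on `f` (the stopping
test is not active). After a step that was rejected because of its ratio, `B` is kept; in the other
two cases a new `B` is computed, subject only to `B_symm` and `B_acc`. -/
structure IsRun : Prop where
  σ_init : p.σmin ≤ t.σ 0
  acc_init : t.acc 0 = p.C
  flag_init : t.flag 0 = true
  B_symm : ∀ k, IsSelfAdjoint (t.B k)
  B_acc : ∀ k, ‖hessian f (t.x k) - t.B k‖ ≤ t.acc k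
  step_descent : ∀ k, t.model f k (t.s k) < t.model f k 0
  step_grad : ∀ k, ∃ θk : ℝ, 0 ≤ θk ∧ θk ≤ p.θ ∧
    ‖∇ (t.model f k) (t.s k)‖ ≤ θk * ‖∇ f (t.x k)‖
  short_step : ∀ k, t.ShortStepRejected f p k →
    t.x (k + 1) = t.x k ∧ t.σ (k + 1) = t.σ k ∧
    t.acc (k + 1) = p.α * (1 - p.θ) * ‖∇ f (t.x k)‖ ∧ t.flag (k + 1) = false
  success : ∀ k, t.Successful f p k →
    t.x (k + 1) = t.x k + t.s k ∧
    (p.η₂ ≤ t.ratio f k →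
      max p.σmin (p.γ₁ * t.σ k) ≤ t.σ (k + 1) ∧ t.σ (k + 1) ≤ t.σ k) ∧
    (t.ratio f k < p.η₂ → t.σ k ≤ t.σ (k + 1) ∧ t.σ (k + 1) ≤ p.γ₂ * t.σ k) ∧
    (1 ≤ ‖t.s k‖ → t.acc (k + 1) = p.C ∧ t.flag (k + 1) = true) ∧
    (‖t.s k‖ < 1 → t.acc (k + 1) = p.α * (1 - p.θ) * ‖∇ f (t.x (k + 1))‖ ∧
      t.flag (k + 1) = false)
  failure : ∀ k, t.RatioRejected f p k →
    t.x (k + 1) = t.x k ∧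
    p.γ₂ * t.σ k ≤ t.σ (k + 1) ∧ t.σ (k + 1) ≤ p.γ₃ * t.σ k ∧
    t.acc (k + 1) = t.acc k ∧ t.flag (k + 1) = t.flag k ∧ t.B (k + 1) = t.B k

/-- `sC` is the Cauchy step of iteration `k`: the minimizer of the cubic model along the steepest
descent half-line. -/
def IsCauchyStep (k : ℕ) (sC : Vec n) : Prop :=
  ∃ a : ℝ, 0 ≤ a ∧
    IsMinOn (fun b : ℝ => t.model f k (-(b • ∇ f (t.x k)))) (Set.Ici 0) a ∧
    sC = -(a • ∇ f (t.x k))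

end Trajectory

/-- Second-order critical points: the gradient vanishes and the Hessian is positive
semidefinite. -/
def SecondOrderCritical (f : Vec n → ℝ) (x : Vec n) : Prop :=
  ∇ f x = 0 ∧ (hessian f x).IsPositive

/-- Q-quadratic convergence of the sequence `x` to `l`. -/
def QQuadraticConv (x : ℕ → Vec n) (l : Vec n) : Prop :=
  Tendsto x atTop (𝓝 l) ∧ ∃ c : ℝ, ∀ᶠ k in atTop, ‖x (k + 1) - l‖ ≤ c * ‖x k - l‖ ^ 2

end ARC

end

/-!
The iterates are analysed through three facts. Write `g_k`, `H_k` for the gradient and the Hessian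
of `f` at `x_k`.

*The regularization parameter is bounded* (`IsRun.exists_σ_le`). The predicted reduction exceeds
`σ_k ‖s_k‖³ / 3`, whereas the model error is at most `L ‖s_k‖³ + ½ ‖H_k - B_k‖ ‖s_k‖²`. For a short
step that passed the length check, `‖H_k - B_k‖ ≤ α (1 - θ) ‖g_k‖ ≤ α (κ_B + σ_k ‖s_k‖) ‖s_k‖`, by
the relative termination rule, and `η₂ < (2 - 3 α) / 2` makes the iteration very successful once
`σ_k` is large. For a step of length at least one it suffices to bound the required accuracy. This
accuracy need not be at most `C`: after a short successful step `s_j` it is a multiple of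
`‖g_{j+1}‖`, which is of order `(1 + σ_j) ‖s_j‖²`. Since `σ_j ‖s_j‖³` is bounded by the total decrease
of `f`, this is at most a constant plus a small multiple of `σ_j` (`IsRun.acc_le`), and an induction
on a common bound for all `σ_j` closes.

*Steps and gradients vanish.* Successful steps tend to zero because `f` decreases by at least a
multiple of `‖s_k‖³` and is bounded below; `‖g_k‖ = O(‖s_k‖)` then gives `g_k → 0` along the whole
run. Moreover the flag eventually stays down, so the required accuracy is a multiple of `‖g_k‖` and
`H_k - B_k → 0`. Hence `B_k` follows the Hessian along convergent subsequences, which yields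
second-order criticality of `x*`.

*The limit is nonsingular.* If the curvature is uniformly positive, then `‖∇f(y)‖` is bounded below
by a multiple of `‖y - x*‖` near `x*`. As `g_k → 0` and `x_{k+1} - x_k → 0`, the iterates are trapped
near `x*` and converge (`tendsto_of_mapClusterPt_of_le_norm`). Eventually all `B_k` are uniformly
positive definite, so `‖s_k‖ = O(‖g_k‖)`, the predicted reduction is at least a multiple of `‖s_k‖²`
and the model error is `o(‖s_k‖²)`: all iterations become very successful
(`IsRun.eventually_verySuccessful`). The lower bound on the predicted reduction comes from the
second-order residual of the subproblem (`IsRun.norm_gradient_model_le`). Finally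
`‖x_{k+1} - x*‖ = O(‖g_{k+1}‖) = O(‖s_k‖²) = O(‖g_k‖²) = O(‖x_k - x*‖²)`.
-/

namespace ARC

/-! ### Taylor estimates and the gradient of the cubic model -/

variable {n : ℕ} {f : Vec n → ℝ}

theorem contDiff_gradient (hf : ContDiff ℝ 2 f) : ContDiff ℝ 1 (fun y => ∇ f y) := by
  have h : ContDiff ℝ 1 (fderiv ℝ f) := hf.fderiv_right (by norm_num)
  exact (InnerProductSpace.toDual ℝ (Vec n)).symm.contDiff.comp h

theorem hasFDerivAt_gradient (hf : ContDiff ℝ 2 f) (x : Vec n) :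
    HasFDerivAt (fun y => ∇ f y) (hessian f x) x :=
  ((contDiff_gradient hf).differentiable (by norm_num) x).hasFDerivAt

theorem continuous_hessian (hf : ContDiff ℝ 2 f) : Continuous (hessian f) :=
  (contDiff_gradient hf).continuous_fderiv (by norm_num)

theorem hasGradientAt_gradient (hf : ContDiff ℝ 2 f) (x : Vec n) : HasGradientAt f (∇ f x) x :=
  (hf.differentiable (by norm_num) x).hasGradientAt

/-- Only the Lipschitz condition along the segment from `x` to `x + s`, based at `x`, is used. The
factor `1 / 2` of the sharp estimate is not needed. -/
theorem norm_gradient_taylor_le (hf : ContDiff ℝ 2 f) {x s : Vec n} {L : ℝ} (hL : 0 ≤ L)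
    (hLip : ∀ β ∈ Set.Icc (0 : ℝ) 1, ‖hessian f (x + β • s) - hessian f x‖ ≤ L * β * ‖s‖) :
    ‖∇ f (x + s) - ∇ f x - hessian f x s‖ ≤ L * ‖s‖ ^ 2 := by
  have hline : ∀ b : ℝ, HasDerivAt (fun b : ℝ => x + b • s) s b := fun b => by
    simpa using ((hasDerivAt_id b).smul_const s).const_add x
  have hder : ∀ b ∈ Set.Icc (0 : ℝ) 1,
      HasDerivWithinAt (fun b : ℝ => ∇ f (x + b • s) - b • hessian f x s)
        (hessian f (x + b • s) s - hessian f x s) (Set.Icc 0 1) b := fun b _ => by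
    have h1 := (hasFDerivAt_gradient hf (x + b • s)).comp_hasDerivAt b (hline b)
    have h2 := (hasDerivAt_id b).smul_const (hessian f x s)
    exact (h1.sub h2).hasDerivWithinAt.congr_deriv (by simp)
  have hbd : ∀ b ∈ Set.Ico (0 : ℝ) 1,
      ‖hessian f (x + b • s) s - hessian f x s‖ ≤ L * ‖s‖ ^ 2 := fun b hb => by
    rw [← sub_apply]
    calc _ ≤ ‖hessian f (x + b • s) - hessian f x‖ * ‖s‖ := ContinuousLinearMap.le_opNorm _ _
      _ ≤ (L * b * ‖s‖) * ‖s‖ := by gcongr; exact hLip b ⟨hb.1, hb.2.le⟩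
      _ ≤ (L * 1 * ‖s‖) * ‖s‖ := by gcongr; exact hb.2.le
      _ = _ := by ring
  have := norm_image_sub_le_of_norm_deriv_le_segment_01' hder hbd
  simp only [one_smul, zero_smul, add_zero, sub_zero] at this
  rwa [sub_right_comm]

/-- The remainder at `b s` has derivative `⟪∇f(x + b s) - ∇f(x) - b H s, s⟫` in `b`, which the estimate
for the gradient, applied to the step `b s`, bounds by `L ‖s‖³`. -/
theorem abs_taylor_le (hf : ContDiff ℝ 2 f) {x s : Vec n} {L : ℝ} (hL : 0 ≤ L)
    (hLip : ∀ β ∈ Set.Icc (0 : ℝ) 1, ‖hessian f (x + β • s) - hessian f x‖ ≤ L * β * ‖s‖) :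
    |f (x + s) - quadModel f (hessian f x) x s| ≤ L * ‖s‖ ^ 3 := by
  have hline : ∀ b : ℝ, HasDerivAt (fun b : ℝ => x + b • s) s b := fun b => by
    simpa using ((hasDerivAt_id b).smul_const s).const_add x
  have hder : ∀ b ∈ Set.Icc (0 : ℝ) 1,
      HasDerivWithinAt
        (fun b : ℝ => f (x + b • s) - b * ⟪∇ f x, s⟫ - b ^ 2 * (1 / 2 * ⟪s, hessian f x s⟫))
        (⟪∇ f (x + b • s) - ∇ f x - hessian f x (b • s), s⟫) (Set.Icc 0 1) b := fun b _ => by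
    have h1 := (hasGradientAt_gradient hf (x + b • s)).hasFDerivAt.comp_hasDerivAt b (hline b)
    have h2 := (hasDerivAt_id b).mul_const ⟪∇ f x, s⟫
    have h3 := (hasDerivAt_pow 2 b).mul_const (1 / 2 * ⟪s, hessian f x s⟫)
    refine ((h1.sub h2).sub h3).hasDerivWithinAt.congr_deriv ?_
    simp only [InnerProductSpace.toDual_apply_apply, inner_sub_left, map_smul, inner_smul_left,
      real_inner_comm s (hessian f x s)]
    simp
    ring
  have hbd : ∀ b ∈ Set.Ico (0 : ℝ) 1,
      ‖⟪∇ f (x + b • s) - ∇ f x - hessian f x (b • s), s⟫‖ ≤ L * ‖s‖ ^ 3 := fun b hb => by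
    have hb1 := hb.2.le
    have hb0 := hb.1
    have hg := norm_gradient_taylor_le hf (x := x) (s := b • s) hL (fun β hβ => by
      have := hLip (β * b) ⟨mul_nonneg hβ.1 hb.1, mul_le_one₀ hβ.2 hb.1 hb1⟩
      rw [smul_smul, norm_smul, Real.norm_of_nonneg hb.1]
      linarith)
    rw [norm_smul, Real.norm_of_nonneg hb.1] at hg
    calc _ ≤ ‖∇ f (x + b • s) - ∇ f x - hessian f x (b • s)‖ * ‖s‖ := norm_inner_le_norm _ _
      _ ≤ (L * (b * ‖s‖) ^ 2) * ‖s‖ := by gcongr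
      _ ≤ (L * (1 * ‖s‖) ^ 2) * ‖s‖ := by gcongr
      _ = _ := by ring
  have := norm_image_sub_le_of_norm_deriv_le_segment_01' hder hbd
  simp only [one_smul, zero_smul, add_zero, Real.norm_eq_abs] at this
  convert this using 2
  rw [quadModel]
  ring

theorem taylor_sub_quadModel_le (hf : ContDiff ℝ 2 f) {x s : Vec n} {B : Vec n →L[ℝ] Vec n}
    {L : ℝ} (hL : 0 ≤ L)
    (hLip : ∀ β ∈ Set.Icc (0 : ℝ) 1, ‖hessian f (x + β • s) - hessian f x‖ ≤ L * β * ‖s‖) :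
    f (x + s) - quadModel f B x s ≤ L * ‖s‖ ^ 3 + 1 / 2 * ‖hessian f x - B‖ * ‖s‖ ^ 2 := by
  have h1 := (abs_le.mp (abs_taylor_le hf hL hLip)).2
  have h2 : ⟪s, (hessian f x - B) s⟫ ≤ ‖hessian f x - B‖ * ‖s‖ ^ 2 :=
    calc _ ≤ ‖s‖ * ‖(hessian f x - B) s‖ := real_inner_le_norm _ _
      _ ≤ ‖s‖ * (‖hessian f x - B‖ * ‖s‖) := by gcongr; exact ContinuousLinearMap.le_opNorm _ _
      _ = _ := by ring
  rw [sub_apply, inner_sub_right] at h2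
  simp only [quadModel] at h1 ⊢
  linarith

theorem hasGradientAt_cubicModel {B : Vec n →L[ℝ] Vec n} (hB : IsSelfAdjoint B) (x s : Vec n)
    (σ : ℝ) :
    HasGradientAt (fun v => cubicModel f B x v σ) (∇ f x + B s + (σ * ‖s‖) • s) s := by
  rw [hasGradientAt_iff_hasFDerivAt]
  have h1 : HasFDerivAt (fun v : Vec n => ⟪∇ f x, v⟫) (innerSL ℝ (∇ f x)) s :=
    (innerSL ℝ (∇ f x)).hasFDerivAt
  have h2 := (hasFDerivAt_id s).inner ℝ (B.hasFDerivAt (x := s))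
  have h3 := hasFDerivAt_norm_rpow s (p := 3) (by norm_num)
  have h4 := ((h1.const_add (f x)).add (h2.const_mul (1 / 2))).add (h3.const_mul (σ / 3))
  have h5 : (fun v => cubicModel f B x v σ) = fun v : Vec n =>
      (f x + ⟪∇ f x, v⟫ + 1 / 2 * ⟪v, B v⟫) + σ / 3 * ‖v‖ ^ (3 : ℝ) := by
    ext v
    simp only [cubicModel, quadModel]
    norm_cast
  rw [h5]
  refine h4.congr_fderiv ?_
  ext v
  have hs : ⟪s, B v⟫ = ⟪B s, v⟫ := (hB.isSymmetric s v).symm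
  have hp : ‖s‖ ^ ((3 : ℝ) - 2) = ‖s‖ := by norm_num
  simp [hp, hs, real_inner_comm v (B s)]
  ring

theorem cubicModel_zero (B : Vec n →L[ℝ] Vec n) (x : Vec n) (σ : ℝ) :
    cubicModel f B x 0 σ = f x := by
  simp [cubicModel, quadModel]

theorem quadModel_zero (B : Vec n →L[ℝ] Vec n) (x : Vec n) : quadModel f B x 0 = f x := by
  simp [quadModel]

end ARC

namespace ARC.Trajectory

/-! ### Invariants of a run -/

variable {n : ℕ} {f : Vec n → ℝ} {p : Params} {t : Trajectory n}

theorem IsRun.step_ne_zero (h : t.IsRun f p) (k : ℕ) : t.s k ≠ 0 := fun h0 => by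
  simpa [h0] using h.step_descent k

theorem IsRun.σmin_le (h : t.IsRun f p) (k : ℕ) : p.σmin ≤ t.σ k := by
  induction k with
  | zero => exact h.σ_init
  | succ k ih =>
    by_cases hS : t.ShortStepRejected f p k
    · rw [(h.short_step k hS).2.1]; exact ih
    rcases lt_or_ge (t.ratio f k) p.η₁ with hr | hr
    · have := (h.failure k ⟨hS, hr⟩).2.1
      nlinarith [p.γ₂_gt, p.σmin_pos]
    · obtain ⟨-, h1, h2, -⟩ := h.success k ⟨hS, hr⟩
      rcases lt_or_ge (t.ratio f k) p.η₂ with hr' | hr'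
      · exact ih.trans (h2 hr').1
      · exact (le_max_left _ _).trans (h1 hr').1

theorem IsRun.σ_pos (h : t.IsRun f p) (k : ℕ) : 0 < t.σ k := p.σmin_pos.trans_le (h.σmin_le k)

/-- The predicted reduction `T₂(x_k, 0) - T₂(x_k, s_k)` exceeds the cubic term of the model. -/
theorem IsRun.lt_predicted_reduction (h : t.IsRun f p) (k : ℕ) :
    t.σ k / 3 * ‖t.s k‖ ^ 3 <
      quadModel f (t.B k) (t.x k) 0 - quadModel f (t.B k) (t.x k) (t.s k) := by
  have := h.step_descent k
  rw [model, model, cubicModel_zero, cubicModel] at this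
  rw [quadModel_zero]
  linarith

theorem IsRun.predicted_reduction_pos (h : t.IsRun f p) (k : ℕ) :
    0 < quadModel f (t.B k) (t.x k) 0 - quadModel f (t.B k) (t.x k) (t.s k) :=
  lt_of_le_of_lt (mul_nonneg (by have := h.σ_pos k; positivity) (by positivity))
    (h.lt_predicted_reduction k)

theorem IsRun.gradient_model (h : t.IsRun f p) (k : ℕ) :
    ∇ (t.model f k) (t.s k) =
      ∇ f (t.x k) + t.B k (t.s k) + (t.σ k * ‖t.s k‖) • t.s k :=
  (hasGradientAt_cubicModel (h.B_symm k) (t.x k) (t.s k) (t.σ k)).gradient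

theorem IsRun.x_succ_of_not_successful (h : t.IsRun f p) {k : ℕ} (hk : ¬ t.Successful f p k) :
    t.x (k + 1) = t.x k := by
  by_cases hS : t.ShortStepRejected f p k
  · exact (h.short_step k hS).1
  · exact (h.failure k ⟨hS, lt_of_not_ge fun hr => hk ⟨hS, hr⟩⟩).1

/-- Either the flag is up and the required accuracy is the coarse one, or the flag is down and the
required accuracy is proportional to the norm of the current gradient. -/
theorem IsRun.flag_acc (h : t.IsRun f p) (k : ℕ) :
    (t.flag k = true ∧ t.acc k = p.C) ∨
      (t.flag k = false ∧ t.acc k = p.α * (1 - p.θ) * ‖∇ f (t.x k)‖) := by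
  induction k with
  | zero => exact Or.inl ⟨h.flag_init, h.acc_init⟩
  | succ k ih =>
    by_cases hS : t.ShortStepRejected f p k
    · obtain ⟨h1, -, h2, h3⟩ := h.short_step k hS
      exact Or.inr ⟨h3, by rw [h2, h1]⟩
    rcases lt_or_ge (t.ratio f k) p.η₁ with hr | hr
    · obtain ⟨h1, -, -, h2, h3, -⟩ := h.failure k ⟨hS, hr⟩
      rwa [h1, h2, h3]
    · obtain ⟨-, -, -, h1, h2⟩ := h.success k ⟨hS, hr⟩
      rcases lt_or_ge ‖t.s k‖ 1 with hs | hs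
      · exact Or.inr (h2 hs).symm
      · exact Or.inl (h1 hs).symm

/-- For a short step the length check guarantees the fine accuracy, whatever the flag: if the flag is
up, then the check was passed because the coarse accuracy is already fine enough. -/
theorem IsRun.norm_hessian_sub_le_of_short (h : t.IsRun f p) {k : ℕ}
    (hS : ¬ t.ShortStepRejected f p k) (hs : ‖t.s k‖ < 1) :
    ‖hessian f (t.x k) - t.B k‖ ≤ p.α * (1 - p.θ) * ‖∇ f (t.x k)‖ := by
  rcases h.flag_acc k with ⟨h1, h2⟩ | ⟨h1, h2⟩
  · exact (h.B_acc k).trans (h2.trans_le (le_of_not_gt fun hC => hS ⟨hs, h1, hC⟩))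
  · exact (h.B_acc k).trans_eq h2

/-- A relative residual below one forces the step to be at least of the order of the gradient. -/
theorem IsRun.norm_gradient_le (h : t.IsRun f p) {κB : ℝ} (hκB : ∀ k, ‖t.B k‖ ≤ κB) (k : ℕ) :
    (1 - p.θ) * ‖∇ f (t.x k)‖ ≤ (κB + t.σ k * ‖t.s k‖) * ‖t.s k‖ := by
  obtain ⟨θk, h0, h1, h2⟩ := h.step_grad k
  have h3 : ‖∇ (t.model f k) (t.s k)‖ ≤ p.θ * ‖∇ f (t.x k)‖ := h2.trans (by gcongr)
  rw [h.gradient_model k] at h3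
  have hσ := (h.σ_pos k).le
  have hB : ‖t.B k (t.s k)‖ ≤ κB * ‖t.s k‖ :=
    ((t.B k).le_opNorm _).trans (by gcongr; exact hκB k)
  have hn : ‖(t.σ k * ‖t.s k‖) • t.s k‖ = t.σ k * ‖t.s k‖ * ‖t.s k‖ := by
    rw [norm_smul, Real.norm_of_nonneg (by positivity)]
  have h4 : ‖∇ f (t.x k)‖ ≤ ‖∇ f (t.x k) + t.B k (t.s k) + (t.σ k * ‖t.s k‖) • t.s k‖ +
      ‖t.B k (t.s k)‖ + ‖(t.σ k * ‖t.s k‖) • t.s k‖ := by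
    calc ‖∇ f (t.x k)‖ = ‖(∇ f (t.x k) + t.B k (t.s k) + (t.σ k * ‖t.s k‖) • t.s k) -
          t.B k (t.s k) - (t.σ k * ‖t.s k‖) • t.s k‖ := by congr 1; abel
      _ ≤ _ := (norm_sub_le _ _).trans (by gcongr; exact norm_sub_le _ _)
  linarith

/-- For short steps both termination rules bound the residual of the subproblem by a multiple of
`‖s_k‖²`. -/
theorem IsRun.norm_gradient_model_le (h : t.IsRun f p) {κB : ℝ} (hκB : ∀ k, ‖t.B k‖ ≤ κB)
    (hstep : (∀ k, ‖∇ (t.model f k) (t.s k)‖ ≤ p.θ * min (‖t.s k‖ ^ 2) ‖∇ f (t.x k)‖) ∨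
      ∀ k, ‖∇ (t.model f k) (t.s k)‖ ≤ p.θ * min 1 ‖t.s k‖ * ‖∇ f (t.x k)‖)
    {k : ℕ} (hs : ‖t.s k‖ < 1) :
    ‖∇ (t.model f k) (t.s k)‖ ≤ (κB + 1) / (1 - p.θ) * (1 + t.σ k) * ‖t.s k‖ ^ 2 := by
  have hκ : 0 ≤ κB := (norm_nonneg _).trans (hκB k)
  have hθ : 0 < 1 - p.θ := by linarith [p.θ_lt]
  have hθ0 := p.θ_pos
  have hσ := h.σ_pos k
  have hN := norm_nonneg (t.s k)
  rw [div_mul_eq_mul_div, div_mul_eq_mul_div, le_div_iff₀ hθ]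
  rcases hstep with ha | hb
  · have h1 : ‖∇ (t.model f k) (t.s k)‖ ≤ 1 * ‖t.s k‖ ^ 2 :=
      (ha k).trans (mul_le_mul p.θ_lt.le (min_le_left _ _) (by positivity) zero_le_one)
    calc ‖∇ (t.model f k) (t.s k)‖ * (1 - p.θ) ≤ (1 * ‖t.s k‖ ^ 2) * 1 := by
          gcongr; linarith
      _ = 1 * 1 * ‖t.s k‖ ^ 2 := by ring
      _ ≤ (κB + 1) * (1 + t.σ k) * ‖t.s k‖ ^ 2 := by gcongr <;> linarith
  · have h1 : ‖∇ (t.model f k) (t.s k)‖ ≤ 1 * ‖t.s k‖ * ‖∇ f (t.x k)‖ :=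
      (hb k).trans (by gcongr; exacts [p.θ_lt.le, min_le_right _ _])
    calc ‖∇ (t.model f k) (t.s k)‖ * (1 - p.θ)
        ≤ (1 * ‖t.s k‖ * ‖∇ f (t.x k)‖) * (1 - p.θ) := by gcongr
      _ = ‖t.s k‖ * ((1 - p.θ) * ‖∇ f (t.x k)‖) := by ring
      _ ≤ ‖t.s k‖ * ((κB + t.σ k * ‖t.s k‖) * ‖t.s k‖) := by
          gcongr ‖t.s k‖ * ?_; exact h.norm_gradient_le hκB k
      _ ≤ ‖t.s k‖ * ((κB + t.σ k * 1) * ‖t.s k‖) := by gcongr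
      _ ≤ ‖t.s k‖ * (((κB + 1) * (1 + t.σ k)) * ‖t.s k‖) := by gcongr; nlinarith
      _ = _ := by ring

/-- After a short step from a sufficiently accurate model the gradient is of second order in the
step. The factor `1 + σ_k` is kept explicit because this estimate is used to bound `σ_k`. -/
theorem IsRun.exists_norm_gradient_add_le (h : t.IsRun f p) (hf : ContDiff ℝ 2 f) {L : ℝ}
    (hL : 0 ≤ L)
    (hLip : ∀ k, ∀ β ∈ Set.Icc (0 : ℝ) 1,
      ‖hessian f (t.x k + β • t.s k) - hessian f (t.x k)‖ ≤ L * β * ‖t.s k‖)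
    {κB : ℝ} (hκB : ∀ k, ‖t.B k‖ ≤ κB) {D : ℝ} (hD : 0 ≤ D)
    (hres : ∀ k, ‖t.s k‖ < 1 →
      ‖∇ (t.model f k) (t.s k)‖ ≤ D * (1 + t.σ k) * ‖t.s k‖ ^ 2) :
    ∃ c : ℝ, 0 < c ∧ ∀ k, ¬ t.ShortStepRejected f p k → ‖t.s k‖ < 1 →
      ‖∇ f (t.x k + t.s k)‖ ≤ c * (1 + t.σ k) * ‖t.s k‖ ^ 2 := by
  have hκ : 0 ≤ κB := (norm_nonneg _).trans (hκB 0)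
  refine ⟨L + κB + 2 + D, by linarith, fun k hS hs => ?_⟩
  have hσ := h.σ_pos k
  have hα := p.α_nonneg
  have hN := norm_nonneg (t.s k)
  set g := ∇ f (t.x k)
  set H := hessian f (t.x k)
  have h1 : ‖∇ f (t.x k + t.s k) - g - H (t.s k)‖ ≤ L * ‖t.s k‖ ^ 2 :=
    norm_gradient_taylor_le hf hL (hLip k)
  have h2 : ‖(H - t.B k) (t.s k)‖ ≤ (κB + t.σ k) * ‖t.s k‖ ^ 2 :=
    calc _ ≤ ‖H - t.B k‖ * ‖t.s k‖ := ContinuousLinearMap.le_opNorm _ _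
      _ ≤ (p.α * (1 - p.θ) * ‖g‖) * ‖t.s k‖ := by
          gcongr; exact h.norm_hessian_sub_le_of_short hS hs
      _ = p.α * ((1 - p.θ) * ‖g‖) * ‖t.s k‖ := by ring
      _ ≤ 1 * ((κB + t.σ k * ‖t.s k‖) * ‖t.s k‖) * ‖t.s k‖ := by
          refine mul_le_mul_of_nonneg_right (mul_le_mul (by linarith [p.α_lt])
            (h.norm_gradient_le hκB k) ?_ zero_le_one) hN
          exact mul_nonneg (by linarith [p.θ_lt]) (norm_nonneg _)
      _ ≤ 1 * ((κB + t.σ k * 1) * ‖t.s k‖) * ‖t.s k‖ := by gcongr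
      _ = _ := by ring
  have h3 := hres k hs
  rw [h.gradient_model k] at h3
  have hn : ‖(t.σ k * ‖t.s k‖) • t.s k‖ = t.σ k * ‖t.s k‖ ^ 2 := by
    rw [norm_smul, Real.norm_of_nonneg (by positivity)]; ring
  have h4 : ‖∇ f (t.x k + t.s k)‖ ≤ ‖∇ f (t.x k + t.s k) - g - H (t.s k)‖ +
      ‖(H - t.B k) (t.s k)‖ + ‖g + t.B k (t.s k) + (t.σ k * ‖t.s k‖) • t.s k‖ +
      ‖(t.σ k * ‖t.s k‖) • t.s k‖ := by
    calc ‖∇ f (t.x k + t.s k)‖ = ‖(∇ f (t.x k + t.s k) - g - H (t.s k)) + (H - t.B k) (t.s k) +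
          (g + t.B k (t.s k) + (t.σ k * ‖t.s k‖) • t.s k) - (t.σ k * ‖t.s k‖) • t.s k‖ := by
          congr 1; rw [sub_apply]; abel
      _ ≤ _ := (norm_sub_le _ _).trans (by gcongr; exact norm_add₃_le)
  calc _ ≤ (L + (κB + t.σ k) + D * (1 + t.σ k) + t.σ k) * ‖t.s k‖ ^ 2 := by linarith
    _ ≤ _ := by gcongr; nlinarith [mul_nonneg hL hσ.le, mul_nonneg hκ hσ.le]

/-! ### Decrease of the objective and boundedness of the regularization parameter -/

theorem IsRun.f_succ_le (h : t.IsRun f p) {k : ℕ} (hk : t.Successful f p k) :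
    f (t.x (k + 1)) ≤ f (t.x k) - p.η₁ * (t.σ k / 3 * ‖t.s k‖ ^ 3) := by
  have h1 := hk.2
  rw [ratio, le_div_iff₀ (h.predicted_reduction_pos k)] at h1
  rw [(h.success k hk).1]
  nlinarith [h.lt_predicted_reduction k, p.η₁_pos]

theorem IsRun.antitone_f (h : t.IsRun f p) : Antitone fun k => f (t.x k) := by
  refine antitone_nat_of_succ_le fun k => ?_
  by_cases hk : t.Successful f p k
  · have h1 := h.f_succ_le hk
    have h2 : 0 ≤ p.η₁ * (t.σ k / 3 * ‖t.s k‖ ^ 3) := by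
      have := h.σ_pos k
      have := p.η₁_pos
      positivity
    linarith
  · rw [h.x_succ_of_not_successful hk]

/-- The cubic term of a successful iteration is bounded by the total decrease of `f`. -/
theorem IsRun.σ_mul_norm_pow_le (h : t.IsRun f p) {flow : ℝ} (hlow : ∀ x, flow ≤ f x) {k : ℕ}
    (hk : t.Successful f p k) :
    t.σ k * ‖t.s k‖ ^ 3 ≤ 3 * (f (t.x 0) - flow) / p.η₁ := by
  rw [le_div_iff₀ p.η₁_pos]
  have h1 := h.f_succ_le hk
  have h2 := h.antitone_f (Nat.zero_le k)
  have h3 := hlow (t.x (k + 1))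
  simp only at h2
  linarith

/-- If the iteration is not very successful, then `σ_k` is controlled by the required accuracy. -/
theorem IsRun.σ_le_of_ratio_lt (h : t.IsRun f p) (hf : ContDiff ℝ 2 f) {L : ℝ} (hL : 0 ≤ L)
    (hLip : ∀ k, ∀ β ∈ Set.Icc (0 : ℝ) 1,
      ‖hessian f (t.x k + β • t.s k) - hessian f (t.x k)‖ ≤ L * β * ‖t.s k‖)
    {κB : ℝ} (hκB : ∀ k, ‖t.B k‖ ≤ κB) {k : ℕ} (hS : ¬ t.ShortStepRejected f p k)
    (hr : t.ratio f k < p.η₂) :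
    ((2 - 3 * p.α) / 2 - p.η₂) * t.σ k ≤ 3 * L + 3 / 2 * (κB + t.acc k) := by
  have hκ : 0 ≤ κB := (norm_nonneg _).trans (hκB k)
  have hacc : 0 ≤ t.acc k := (norm_nonneg _).trans (h.B_acc k)
  have hσ := h.σ_pos k
  have hα := p.α_nonneg
  have hN : 0 < ‖t.s k‖ := norm_pos_iff.mpr (h.step_ne_zero k)
  have hE : ‖hessian f (t.x k) - t.B k‖ * ‖t.s k‖ ^ 2 ≤
      (p.α * t.σ k + κB + t.acc k) * ‖t.s k‖ ^ 3 := by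
    rcases lt_or_ge ‖t.s k‖ 1 with hs | hs
    · calc _ ≤ (p.α * (1 - p.θ) * ‖∇ f (t.x k)‖) * ‖t.s k‖ ^ 2 := by
            gcongr; exact h.norm_hessian_sub_le_of_short hS hs
        _ = p.α * ((1 - p.θ) * ‖∇ f (t.x k)‖) * ‖t.s k‖ ^ 2 := by ring
        _ ≤ p.α * ((κB + t.σ k * ‖t.s k‖) * ‖t.s k‖) * ‖t.s k‖ ^ 2 := by
            gcongr p.α * ?_ * _; exact h.norm_gradient_le hκB k
        _ ≤ p.α * ((κB + t.σ k * 1) * ‖t.s k‖) * ‖t.s k‖ ^ 2 := by gcongr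
        _ = (p.α * t.σ k + p.α * κB) * ‖t.s k‖ ^ 3 := by ring
        _ ≤ _ := by gcongr ?_ * _; nlinarith [p.α_lt]
    · calc _ ≤ t.acc k * (‖t.s k‖ ^ 2 * 1) := by rw [mul_one]; gcongr; exact h.B_acc k
        _ ≤ t.acc k * (‖t.s k‖ ^ 2 * ‖t.s k‖) := by gcongr
        _ = t.acc k * ‖t.s k‖ ^ 3 := by ring
        _ ≤ _ := by gcongr; nlinarith
  have h1 := taylor_sub_quadModel_le (B := t.B k) hf hL (hLip k)
  have h2 := h.lt_predicted_reduction k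
  rw [ratio, div_lt_iff₀ (h.predicted_reduction_pos k)] at hr
  rw [quadModel_zero] at h2 hr
  have hη : 0 ≤ 1 - p.η₂ := by linarith [p.η₂_lt]
  have h3 : (1 - p.η₂) * (t.σ k / 3) * ‖t.s k‖ ^ 3 ≤
      (L + 1 / 2 * (p.α * t.σ k + κB + t.acc k)) * ‖t.s k‖ ^ 3 := by
    have := mul_le_mul_of_nonneg_left h2.le hη
    linarith
  have h4 := le_of_mul_le_mul_right h3 (by positivity)
  linarith

/-- The required accuracy is bounded by a constant plus an arbitrarily small multiple of any bound
on the earlier values of `σ`. Indeed the flag may go down after a short successful step `s_j`, in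
which case the accuracy is at most `c (1 + σ_j) ‖s_j‖²`; here `σ_j ‖s_j‖³` is bounded by the total
decrease of `f`, so `σ_j ‖s_j‖²` is small compared to `σ_j` unless it is bounded. -/
theorem IsRun.acc_le (h : t.IsRun f p) {c F : ℝ} (hc : 0 < c) (hF : 0 ≤ F)
    (hgrad : ∀ k, ¬ t.ShortStepRejected f p k → ‖t.s k‖ < 1 →
      ‖∇ f (t.x k + t.s k)‖ ≤ c * (1 + t.σ k) * ‖t.s k‖ ^ 2)
    (hsum : ∀ k, t.Successful f p k → t.σ k * ‖t.s k‖ ^ 3 ≤ F)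
    {δ S : ℝ} (hδ : 0 < δ) (hS0 : 0 ≤ S) {k : ℕ} (hS : ∀ j < k, t.σ j ≤ S) :
    t.acc k ≤ p.C + c * (1 + (δ * S + F / δ)) := by
  have hpos : 0 ≤ c * (1 + (δ * S + F / δ)) := by positivity
  induction k with
  | zero => rw [h.acc_init]; linarith
  | succ k ih =>
    have ih := ih fun j hj => hS j (hj.trans k.lt_succ_self)
    by_cases hR : t.ShortStepRejected f p k
    · rw [(h.short_step k hR).2.2.1]
      linarith [hR.2.2]
    rcases lt_or_ge (t.ratio f k) p.η₁ with hr | hr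
    · rw [(h.failure k ⟨hR, hr⟩).2.2.2.1]
      exact ih
    · obtain ⟨hx, -, -, h1, h2⟩ := h.success k ⟨hR, hr⟩
      rcases lt_or_ge ‖t.s k‖ 1 with hs | hs
      · have hσ := h.σ_pos k
        have hN := norm_nonneg (t.s k)
        have hkey : t.σ k * ‖t.s k‖ ^ 2 ≤ δ * S + F / δ := by
          rcases le_total ‖t.s k‖ δ with hd | hd
          · calc t.σ k * ‖t.s k‖ ^ 2 = t.σ k * (‖t.s k‖ * ‖t.s k‖) := by ring
              _ ≤ S * (δ * 1) := by
                gcongr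
                exact hS k k.lt_succ_self
              _ ≤ _ := by have : 0 ≤ F / δ := by positivity
                          linarith
          · have : t.σ k * ‖t.s k‖ ^ 2 ≤ F / δ := by
              rw [le_div_iff₀ hδ]
              calc t.σ k * ‖t.s k‖ ^ 2 * δ ≤ t.σ k * ‖t.s k‖ ^ 2 * ‖t.s k‖ := by gcongr
                _ = t.σ k * ‖t.s k‖ ^ 3 := by ring
                _ ≤ F := hsum k ⟨hR, hr⟩
            have : 0 ≤ δ * S := by positivity
            linarith
        have hα : p.α * (1 - p.θ) ≤ 1 :=
          mul_le_one₀ (by linarith [p.α_lt]) (by linarith [p.θ_lt]) (by linarith [p.θ_pos])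
        rw [(h2 hs).1, hx]
        calc _ ≤ 1 * ‖∇ f (t.x k + t.s k)‖ := by gcongr
          _ ≤ c * (1 + t.σ k) * ‖t.s k‖ ^ 2 := by rw [one_mul]; exact hgrad k hR hs
          _ = c * (‖t.s k‖ ^ 2 + t.σ k * ‖t.s k‖ ^ 2) := by ring
          _ ≤ c * (1 + (δ * S + F / δ)) := by gcongr; exact pow_le_one₀ hN hs.le
          _ ≤ _ := by linarith [p.C_pos]
      · rw [(h1 hs).1]; linarith

theorem IsRun.exists_σ_le (h : t.IsRun f p) (hf : ContDiff ℝ 2 f) {flow : ℝ}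
    (hlow : ∀ x, flow ≤ f x) {L : ℝ} (hL : 0 ≤ L)
    (hLip : ∀ k, ∀ β ∈ Set.Icc (0 : ℝ) 1,
      ‖hessian f (t.x k + β • t.s k) - hessian f (t.x k)‖ ≤ L * β * ‖t.s k‖)
    {κB : ℝ} (hκB : ∀ k, ‖t.B k‖ ≤ κB) {c : ℝ} (hc : 0 < c)
    (hgrad : ∀ k, ¬ t.ShortStepRejected f p k → ‖t.s k‖ < 1 →
      ‖∇ f (t.x k + t.s k)‖ ≤ c * (1 + t.σ k) * ‖t.s k‖ ^ 2) :
    ∃ S : ℝ, ∀ k, t.σ k ≤ S := by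
  have hκ : 0 ≤ κB := (norm_nonneg _).trans (hκB 0)
  have hμ : 0 < (2 - 3 * p.α) / 2 - p.η₂ := by linarith [p.η₂_lt]
  set μ := (2 - 3 * p.α) / 2 - p.η₂
  have hγ : 0 < p.γ₃ := by linarith [p.γ₂_gt, p.γ₃_gt]
  set F := 3 * (f (t.x 0) - flow) / p.η₁
  have hF : 0 ≤ F := div_nonneg (by linarith [hlow (t.x 0)]) p.η₁_pos.le
  -- `δ` is chosen so small that a failure at level `σ_k ≤ S` raises `σ` to at most `S / 2 + const`.
  obtain ⟨δ, hδ, hδ2⟩ : ∃ δ : ℝ, 0 < δ ∧ p.γ₃ * (3 / 2 * c) * δ ≤ μ / 2 :=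
    ⟨μ / 2 / (p.γ₃ * (3 / 2 * c)), by positivity, (mul_div_cancel₀ _ (by positivity)).le⟩
  set K := 3 * L + 3 / 2 * (κB + p.C + c * (1 + F / δ))
  have hK : 0 ≤ K := by have := p.C_pos; positivity
  set S := max (t.σ 0) (2 * p.γ₃ * K / μ)
  have hS0 : 0 ≤ S := (h.σ_pos 0).le.trans (le_max_left _ _)
  refine ⟨S, fun k => ?_⟩
  induction k using Nat.strong_induction_on with
  | _ k ih =>
    rcases k with _ | k
    · exact le_max_left _ _
    have ihk := ih k k.lt_succ_self
    by_cases hR : t.ShortStepRejected f p k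
    · rw [(h.short_step k hR).2.1]; exact ihk
    rcases lt_or_ge (t.ratio f k) p.η₂ with hr | hr
    · have hstep : t.σ (k + 1) ≤ p.γ₃ * t.σ k := by
        rcases lt_or_ge (t.ratio f k) p.η₁ with hr' | hr'
        · exact (h.failure k ⟨hR, hr'⟩).2.2.1
        · refine ((h.success k ⟨hR, hr'⟩).2.2.1 hr).2.trans ?_
          have := (h.σ_pos k).le
          gcongr
          exact p.γ₃_gt.le
      have h1 : μ * t.σ k ≤ _ := h.σ_le_of_ratio_lt hf hL hLip hκB hR hr
      have h2 := h.acc_le hc hF hgrad (fun j hj => h.σ_mul_norm_pow_le hlow hj) hδ hS0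
        (k := k) (fun j hj => ih j (hj.trans k.lt_succ_self))
      have h3 : μ * t.σ k ≤ K + 3 / 2 * c * δ * S := by simp only [K]; linarith
      have h4 : 2 * p.γ₃ * K ≤ S * μ := by
        rw [← div_le_iff₀ hμ]; exact le_max_right _ _
      have h5 := mul_le_mul_of_nonneg_left h3 hγ.le
      have h6 := mul_le_mul_of_nonneg_right hδ2 hS0
      refine hstep.trans (le_of_mul_le_mul_left ?_ hμ)
      linarith
    · exact ((h.success k ⟨hR, p.η₁_le.trans hr⟩).2.1 hr).2.trans ihk

end ARC.Trajectory

namespace ARC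

/-! ### Isolated zeros and nonsingular critical points -/

/-- A sequence whose consecutive differences tend to zero and along which `g` tends to zero
converges to every cluster point `l` at which `g` grows at least linearly: once it is close to `l`
it cannot leave a neighbourhood of `l`, since the steps are too short to jump over the shell where
`g` is bounded away from zero. -/
theorem tendsto_of_mapClusterPt_of_le_norm {E F : Type*} [NormedAddCommGroup E]
    [NormedAddCommGroup F] {x : ℕ → E} {l : E} {g : E → F} {c : ℝ} (hc : 0 < c)
    (hl : MapClusterPt l atTop x) (hlb : ∀ᶠ y in 𝓝 l, c * ‖y - l‖ ≤ ‖g y‖)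
    (hg : Tendsto (fun k => g (x k)) atTop (𝓝 0))
    (hd : Tendsto (fun k => x (k + 1) - x k) atTop (𝓝 0)) : Tendsto x atTop (𝓝 l) := by
  obtain ⟨r, hr, hball⟩ := Metric.eventually_nhds_iff.mp hlb
  rw [Metric.tendsto_atTop]
  intro ε₀ hε₀
  obtain ⟨ε, hε, hεr, hεε⟩ : ∃ ε, 0 < ε ∧ ε ≤ r ∧ ε / 2 ≤ ε₀ :=
    ⟨min r ε₀, lt_min hr hε₀, min_le_left _ _, by linarith [min_le_right r ε₀]⟩
  have hg' := hg.norm.eventually_lt_const (u := c * (ε / 2)) (by rw [norm_zero]; positivity)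
  have hd' := hd.norm.eventually_lt_const (u := ε / 2) (by rw [norm_zero]; positivity)
  obtain ⟨K, hK⟩ := eventually_atTop.mp (hg'.and hd')
  have hfreq := hl.frequently (Metric.ball_mem_nhds l (half_pos hε))
  obtain ⟨m, hm, hxm⟩ := (frequently_atTop.mp hfreq) K
  refine ⟨m, fun k hk => lt_of_lt_of_le ?_ hεε⟩
  induction k, hk using Nat.le_induction with
  | base => exact hxm
  | succ k hk ih =>
    have hclose : dist (x (k + 1)) l < ε := by
      have h1 := dist_triangle (x (k + 1)) (x k) l
      have h2 := (hK k (hm.trans hk)).2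
      rw [← dist_eq_norm] at h2
      linarith
    have h3 := (hball (hclose.trans_le hεr)).trans_lt (hK (k + 1) (by omega)).1
    rw [dist_eq_norm]
    exact lt_of_mul_lt_mul_left h3 hc.le

/-- The Hessian at `l` expands norms by at least `lam`, and near `l` the gradient differs from its
linearization by at most `lam / 2 * ‖y - l‖`. -/
theorem eventually_le_norm_gradient {n : ℕ} {f : Vec n → ℝ} (hf : ContDiff ℝ 2 f) {l : Vec n}
    (hl : ∇ f l = 0) {lam : ℝ} (hlam : 0 < lam)
    (hH : ∀ v, lam * ‖v‖ ^ 2 ≤ ⟪v, hessian f l v⟫) :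
    ∀ᶠ y in 𝓝 l, lam / 2 * ‖y - l‖ ≤ ‖∇ f y‖ := by
  have h1 := (hasFDerivAt_gradient hf l).isLittleO.bound (half_pos hlam)
  filter_upwards [h1] with y hy
  rw [hl, sub_zero] at hy
  have h2 : lam * ‖y - l‖ ≤ ‖hessian f l (y - l)‖ := by
    rcases (norm_nonneg (y - l)).eq_or_lt with h0 | h0
    · rw [← h0, mul_zero]; exact norm_nonneg _
    · refine le_of_mul_le_mul_right ?_ h0
      have := (hH (y - l)).trans (real_inner_le_norm _ _)
      linarith
  have h3 := norm_sub_norm_le (hessian f l (y - l)) (∇ f y)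
  rw [norm_sub_rev] at h3
  linarith

theorem tendsto_inner_apply {n : ℕ} {ι : Type*} {u : Filter ι} {B : ι → Vec n →L[ℝ] Vec n}
    {A : Vec n →L[ℝ] Vec n} (h : Tendsto B u (𝓝 A)) (v w : Vec n) :
    Tendsto (fun i => ⟪v, B i w⟫) u (𝓝 ⟪v, A w⟫) :=
  tendsto_const_nhds.inner (((ContinuousLinearMap.apply ℝ (Vec n) w).continuous.tendsto A).comp h)

theorem forall_half_mul_norm_sq_le {n : ℕ} {A B : Vec n →L[ℝ] Vec n} {lam : ℝ}
    (hA : ∀ v, lam * ‖v‖ ^ 2 ≤ ⟪v, A v⟫) (hAB : ‖A - B‖ ≤ lam / 2) (v : Vec n) :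
    lam / 2 * ‖v‖ ^ 2 ≤ ⟪v, B v⟫ := by
  have h1 : ⟪v, (A - B) v⟫ ≤ lam / 2 * ‖v‖ ^ 2 :=
    calc _ ≤ ‖v‖ * ‖(A - B) v‖ := real_inner_le_norm _ _
      _ ≤ ‖v‖ * (lam / 2 * ‖v‖) := by gcongr; exact ContinuousLinearMap.le_of_opNorm_le _ hAB v
      _ = _ := by ring
  rw [sub_apply, inner_sub_right] at h1
  linarith [hA v]

namespace Trajectory

/-! ### Asymptotics of steps, gradients and Hessian errors -/

variable {n : ℕ} {f : Vec n → ℝ} {p : Params} {t : Trajectory n}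

theorem IsRun.eventually_norm_step_lt (h : t.IsRun f p) {flow : ℝ} (hlow : ∀ x, flow ≤ f x)
    {ε : ℝ} (hε : 0 < ε) : ∀ᶠ k in atTop, t.Successful f p k → ‖t.s k‖ < ε := by
  have hbdd : BddBelow (Set.range fun k => f (t.x k)) := ⟨flow, by rintro _ ⟨k, rfl⟩; exact hlow _⟩
  have h1 := tendsto_atTop_ciInf h.antitone_f hbdd
  have h2 := h1.sub (h1.comp (tendsto_add_atTop_nat 1))
  rw [sub_self] at h2
  have hη := p.η₁_pos
  have hσm := p.σmin_pos
  have hpos : 0 < p.η₁ * (p.σmin / 3 * ε ^ 3) := by positivity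
  filter_upwards [h2.eventually_lt_const hpos] with k hk hsucc
  by_contra! hge
  have h3 := h.f_succ_le hsucc
  have h4 : p.η₁ * (p.σmin / 3 * ε ^ 3) ≤ p.η₁ * (t.σ k / 3 * ‖t.s k‖ ^ 3) := by
    have := h.σmin_le k
    have := h.σ_pos k
    gcongr
  simp only [Function.comp_apply] at hk
  linarith

/-- Every iterate is the starting point of a later successful iteration. -/
theorem IsRun.exists_successful_ge (h : t.IsRun f p)
    (hinf : ∃ᶠ k in atTop, t.Successful f p k) (k : ℕ) :
    ∃ m ≥ k, t.Successful f p m ∧ t.x m = t.x k := by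
  obtain ⟨N, hN, hsN⟩ := (frequently_atTop.mp hinf) k
  induction hN using Nat.decreasingInduction with
  | self => exact ⟨N, le_rfl, hsN, rfl⟩
  | of_succ k hk ih =>
    by_cases hs : t.Successful f p k
    · exact ⟨k, le_rfl, hs, rfl⟩
    · obtain ⟨m, hm, hsm, hx⟩ := ih
      exact ⟨m, k.le_succ.trans hm, hsm, hx.trans (h.x_succ_of_not_successful hs)⟩

theorem IsRun.tendsto_gradient (h : t.IsRun f p) {flow : ℝ} (hlow : ∀ x, flow ≤ f x)
    (hinf : ∃ᶠ k in atTop, t.Successful f p k) {κB : ℝ} (hκB : ∀ k, ‖t.B k‖ ≤ κB) {S : ℝ}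
    (hS : ∀ k, t.σ k ≤ S) : Tendsto (fun k => ∇ f (t.x k)) atTop (𝓝 0) := by
  have hκ : 0 ≤ κB := (norm_nonneg _).trans (hκB 0)
  have hS0 : 0 < S := (h.σ_pos 0).trans_le (hS 0)
  have hθ : 0 < 1 - p.θ := by linarith [p.θ_lt]
  rw [Metric.tendsto_atTop]
  intro ε hε
  have hδ : 0 < min 1 ((1 - p.θ) * ε / (κB + S)) := by positivity
  obtain ⟨K, hK⟩ := eventually_atTop.mp (h.eventually_norm_step_lt hlow hδ)
  refine ⟨K, fun k hk => ?_⟩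
  obtain ⟨m, hm, hsm, hx⟩ := h.exists_successful_ge hinf k
  have hs := hK m (hk.trans hm) hsm
  have hs1 := (hs.trans_le (min_le_left _ _)).le
  have hs2 := hs.trans_le (min_le_right _ _)
  rw [lt_div_iff₀ (by positivity)] at hs2
  rw [dist_zero_right, ← hx]
  refine lt_of_mul_lt_mul_left ?_ hθ.le
  have hσ := h.σ_pos m
  calc _ ≤ (κB + t.σ m * ‖t.s m‖) * ‖t.s m‖ := h.norm_gradient_le hκB m
    _ ≤ (κB + S * 1) * ‖t.s m‖ := by gcongr; exact hS m
    _ < _ := by linarith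

theorem IsRun.tendsto_x_succ_sub (h : t.IsRun f p) {flow : ℝ} (hlow : ∀ x, flow ≤ f x) :
    Tendsto (fun k => t.x (k + 1) - t.x k) atTop (𝓝 0) := by
  rw [Metric.tendsto_nhds]
  intro ε hε
  filter_upwards [h.eventually_norm_step_lt hlow hε] with k hk
  rw [dist_zero_right]
  by_cases hs : t.Successful f p k
  · rw [(h.success k hs).1, add_sub_cancel_left]; exact hk hs
  · rw [h.x_succ_of_not_successful hs, sub_self, norm_zero]; exact hε

/-- After the first late successful iteration the flag stays down, because late successful steps
are short; hence no step is rejected by the length check any more. -/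
theorem IsRun.eventually_flag_eq_false (h : t.IsRun f p) {flow : ℝ} (hlow : ∀ x, flow ≤ f x)
    (hinf : ∃ᶠ k in atTop, t.Successful f p k) : ∀ᶠ k in atTop, t.flag k = false := by
  obtain ⟨K, hK⟩ := eventually_atTop.mp (h.eventually_norm_step_lt hlow one_pos)
  obtain ⟨m, hm, hsm⟩ := (frequently_atTop.mp hinf) K
  refine eventually_atTop.mpr ⟨m + 1, fun k hk => ?_⟩
  induction k, hk using Nat.le_induction with
  | base => exact ((h.success m hsm).2.2.2.2 (hK m hm hsm)).2
  | succ k hk ih =>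
    have hR : ¬ t.ShortStepRejected f p k := fun hR => by simp [hR.2.1] at ih
    rcases lt_or_ge (t.ratio f k) p.η₁ with hr | hr
    · rw [(h.failure k ⟨hR, hr⟩).2.2.2.2.1]; exact ih
    · exact ((h.success k ⟨hR, hr⟩).2.2.2.2 (hK k (by omega) ⟨hR, hr⟩)).2

/-- Once the flag is down the required accuracy is a multiple of the norm of the gradient. -/
theorem IsRun.tendsto_hessian_sub (h : t.IsRun f p)
    (hflag : ∀ᶠ k in atTop, t.flag k = false)
    (hg : Tendsto (fun k => ∇ f (t.x k)) atTop (𝓝 0)) :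
    Tendsto (fun k => ‖hessian f (t.x k) - t.B k‖) atTop (𝓝 0) := by
  have h1 : Tendsto (fun k => p.α * (1 - p.θ) * ‖∇ f (t.x k)‖) atTop (𝓝 0) := by
    simpa using hg.norm.const_mul (p.α * (1 - p.θ))
  refine squeeze_zero' (Eventually.of_forall fun _ => norm_nonneg _) ?_ h1
  filter_upwards [hflag] with k hk
  rcases h.flag_acc k with ⟨hf', -⟩ | ⟨-, ha⟩
  · simp [hk] at hf'
  · exact (h.B_acc k).trans_eq ha

/-- Under positive curvature a descent step for the model is at most of the order of the gradient. -/
theorem IsRun.norm_step_le (h : t.IsRun f p) {μ : ℝ} {k : ℕ}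
    (hB : ∀ v, μ * ‖v‖ ^ 2 ≤ ⟪v, t.B k v⟫) : μ * ‖t.s k‖ ≤ 2 * ‖∇ f (t.x k)‖ := by
  have hN : 0 < ‖t.s k‖ := norm_pos_iff.mpr (h.step_ne_zero k)
  have hσ := h.σ_pos k
  have h1 := h.lt_predicted_reduction k
  rw [quadModel_zero, quadModel] at h1
  have h2 : -⟪∇ f (t.x k), t.s k⟫ ≤ ‖∇ f (t.x k)‖ * ‖t.s k‖ :=
    (neg_le_abs _).trans (abs_real_inner_le_norm _ _)
  have h3 : 0 ≤ t.σ k / 3 * ‖t.s k‖ ^ 3 := by positivity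
  refine le_of_mul_le_mul_right ?_ hN
  linarith [hB (t.s k)]

/-- If the residual of the subproblem is of second order in a short step, the predicted reduction
is of the order of the curvature term. -/
theorem IsRun.le_predicted_reduction (h : t.IsRun f p) {μ R : ℝ} {k : ℕ}
    (hB : ∀ v, μ * ‖v‖ ^ 2 ≤ ⟪v, t.B k v⟫)
    (hres : ‖∇ (t.model f k) (t.s k)‖ ≤ R * ‖t.s k‖ ^ 2) :
    (μ / 2 - R * ‖t.s k‖) * ‖t.s k‖ ^ 2 ≤
      quadModel f (t.B k) (t.x k) 0 - quadModel f (t.B k) (t.x k) (t.s k) := by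
  have hσ := h.σ_pos k
  have h1 : ⟪∇ (t.model f k) (t.s k), t.s k⟫ ≤ R * ‖t.s k‖ ^ 2 * ‖t.s k‖ :=
    (real_inner_le_norm _ _).trans (by gcongr)
  rw [h.gradient_model k, inner_add_left, inner_add_left, real_inner_smul_left,
    real_inner_self_eq_norm_sq, real_inner_comm (t.s k) (t.B k (t.s k))] at h1
  rw [quadModel_zero, quadModel]
  have h2 : 0 ≤ t.σ k * ‖t.s k‖ * ‖t.s k‖ ^ 2 := by positivity
  linarith [hB (t.s k)]

/-- Eventually the ratio exceeds `η₂`, because the model error is `o(‖s_k‖²)` while the predicted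
reduction is at least a multiple of `‖s_k‖²`. -/
theorem IsRun.eventually_verySuccessful (h : t.IsRun f p) (hf : ContDiff ℝ 2 f) {L : ℝ}
    (hL : 0 ≤ L)
    (hLip : ∀ k, ∀ β ∈ Set.Icc (0 : ℝ) 1,
      ‖hessian f (t.x k + β • t.s k) - hessian f (t.x k)‖ ≤ L * β * ‖t.s k‖)
    (hflag : ∀ᶠ k in atTop, t.flag k = false)
    (hBH : Tendsto (fun k => ‖hessian f (t.x k) - t.B k‖) atTop (𝓝 0))
    {μ R : ℝ} (hμ : 0 < μ) (hB : ∀ᶠ k in atTop, ∀ v, μ * ‖v‖ ^ 2 ≤ ⟪v, t.B k v⟫)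
    (hs : Tendsto (fun k => ‖t.s k‖) atTop (𝓝 0))
    (hres : ∀ᶠ k in atTop, ‖∇ (t.model f k) (t.s k)‖ ≤ R * ‖t.s k‖ ^ 2) :
    ∀ᶠ k in atTop, t.VerySuccessful f p k := by
  have hη : 0 < 1 - p.η₂ := by linarith [p.η₂_lt, p.α_nonneg]
  have h1 : Tendsto (fun k => L * ‖t.s k‖ + 1 / 2 * ‖hessian f (t.x k) - t.B k‖) atTop (𝓝 0) := by
    simpa only [mul_zero, add_zero] using (hs.const_mul L).add (hBH.const_mul (1 / 2))
  have h2 : Tendsto (fun k => (1 - p.η₂) * (μ / 2 - R * ‖t.s k‖)) atTop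
      (𝓝 ((1 - p.η₂) * (μ / 2))) := by
    simpa using ((hs.const_mul R).const_sub (μ / 2)).const_mul (1 - p.η₂)
  filter_upwards [hflag, hB, hres, h1.eventually_lt h2 (by positivity)] with k hfk hBk hrk hk
  refine ⟨fun hR => by simp [hR.2.1] at hfk, ?_⟩
  rw [ratio, le_div_iff₀ (h.predicted_reduction_pos k)]
  have h3 := mul_le_mul_of_nonneg_left (h.le_predicted_reduction hBk hrk) hη.le
  have h4 := taylor_sub_quadModel_le (B := t.B k) hf hL (hLip k)
  have h5 := mul_le_mul_of_nonneg_right hk.le (sq_nonneg ‖t.s k‖)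
  rw [quadModel_zero] at *
  linarith

theorem IsRun.secondOrderCritical (h : t.IsRun f p) (hf : ContDiff ℝ 2 f)
    (hg : Tendsto (fun k => ∇ f (t.x k)) atTop (𝓝 0)) {φ : ℕ → ℕ} (hφ : Tendsto φ atTop atTop)
    {l : Vec n} (hconv : Tendsto (fun i => t.x (φ i)) atTop (𝓝 l))
    (hB : Tendsto (fun i => t.B (φ i)) atTop (𝓝 (hessian f l)))
    (hpos : ∀ᶠ i in atTop, ∀ v : Vec n, 0 ≤ ⟪v, t.B (φ i) v⟫) : SecondOrderCritical f l := by
  refine ⟨tendsto_nhds_unique (((contDiff_gradient hf).continuous.tendsto l).comp hconv)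
    (hg.comp hφ), ?_⟩
  rw [ContinuousLinearMap.isPositive_iff]
  refine ⟨fun u v => ?_, fun v => ?_⟩
  · change ⟪hessian f l u, v⟫ = ⟪u, hessian f l v⟫
    rw [real_inner_comm]
    refine tendsto_nhds_unique (tendsto_inner_apply hB v u)
      ((tendsto_inner_apply hB u v).congr fun i => ?_)
    rw [real_inner_comm]
    exact ((h.B_symm (φ i)).isSymmetric v u)
  · rw [real_inner_comm]
    exact ge_of_tendsto (tendsto_inner_apply hB v v) (hpos.mono fun i hi => hi v)

end Trajectory

end ARC

namespace ARC.Trajectory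

/-! ### Quadratic rate of convergence -/

variable {n : ℕ} {f : Vec n → ℝ} {p : Params} {t : Trajectory n}

theorem IsRun.qQuadraticConv (h : t.IsRun f p) (hf : ContDiff ℝ 2 f) {c S : ℝ} (hc : 0 < c)
    (hS : ∀ k, t.σ k ≤ S)
    (hgrad : ∀ k, ¬ t.ShortStepRejected f p k → ‖t.s k‖ < 1 →
      ‖∇ f (t.x k + t.s k)‖ ≤ c * (1 + t.σ k) * ‖t.s k‖ ^ 2)
    {l : Vec n} (hx : Tendsto t.x atTop (𝓝 l)) (hl : ∇ f l = 0)
    {ν μ : ℝ} (hν : 0 < ν) (hμ : 0 < μ) (hlb : ∀ᶠ y in 𝓝 l, ν * ‖y - l‖ ≤ ‖∇ f y‖)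
    (hB : ∀ᶠ k in atTop, ∀ v, μ * ‖v‖ ^ 2 ≤ ⟪v, t.B k v⟫)
    (hs : ∀ᶠ k in atTop, ‖t.s k‖ < 1)
    (hsucc : ∀ᶠ k in atTop, t.Successful f p k) : QQuadraticConv t.x l := by
  refine ⟨hx, ?_⟩
  have hS0 : 0 < S := (h.σ_pos 0).trans_le (hS 0)
  obtain ⟨M, hM⟩ := (hasFDerivAt_gradient hf l).isBigO_sub.bound
  refine ⟨c * (1 + S) * (2 * M / μ) ^ 2 / ν, ?_⟩
  filter_upwards [hx.eventually hM, (hx.comp (tendsto_add_atTop_nat 1)).eventually hlb, hB, hs,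
    hsucc] with k hMk hlbk hBk hsk hsuck
  rw [hl, sub_zero] at hMk
  rw [Function.comp_apply] at hlbk
  have h1 : ‖t.s k‖ ≤ 2 * M / μ * ‖t.x k - l‖ := by
    rw [div_mul_eq_mul_div, le_div_iff₀ hμ]
    linarith [h.norm_step_le hBk]
  have h2 : ν * ‖t.x (k + 1) - l‖ ≤ c * (1 + S) * (2 * M / μ * ‖t.x k - l‖) ^ 2 := by
    rw [(h.success k hsuck).1] at hlbk ⊢
    refine hlbk.trans ((hgrad k hsuck.1 hsk).trans ?_)
    have := h.σ_pos k
    gcongr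
    exact hS k
  rw [div_mul_eq_mul_div, le_div_iff₀ hν]
  linarith

end ARC.Trajectory

theorem mainTheorem3 {n : ℕ} (f : ARC.Vec n → ℝ) (p : ARC.Params) (t : ARC.Trajectory n)
    (hrun : t.IsRun f p)
    (hf : ContDiff ℝ 2 f)
    (flow : ℝ) (hlow : ∀ x, flow ≤ f x)
    (L : ℝ)
    (hLip : ∀ k, ∀ β ∈ Set.Icc (0 : ℝ) 1,
      ‖ARC.hessian f (t.x k + β • t.s k) - ARC.hessian f (t.x k)‖ ≤ L * β * ‖t.s k‖)
    (κB : ℝ) (hκB : ∀ k, ‖t.B k‖ ≤ κB)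
    (hstep :
      (∀ k, ‖∇ (t.model f k) (t.s k)‖ ≤ p.θ * min (‖t.s k‖ ^ 2) ‖∇ f (t.x k)‖) ∨
      ((∀ k, ‖∇ (t.model f k) (t.s k)‖ ≤ p.θ * min 1 ‖t.s k‖ * ‖∇ f (t.x k)‖) ∧
        ∃ κH : ℝ, ∀ k, ∀ β ∈ Set.Icc (0 : ℝ) 1, ‖ARC.hessian f (t.x k + β • t.s k)‖ ≤ κH))
    (φ : ℕ → ℕ) (hφ : StrictMono φ) (hsucc : ∀ i, t.Successful f p (φ i))
    (xstar : ARC.Vec n) (hconv : Tendsto (fun i => t.x (φ i)) atTop (𝓝 xstar))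
    (hpos : ∀ᶠ i in atTop, ∀ v : ARC.Vec n, v ≠ 0 → 0 < ⟪v, t.B (φ i) v⟫) :
    ARC.SecondOrderCritical f xstar ∧
    ((∃ lam : ℝ, 0 < lam ∧ ∀ᶠ i in atTop, ∀ v : ARC.Vec n, lam * ‖v‖ ^ 2 ≤ ⟪v, t.B (φ i) v⟫) →
      Tendsto t.x atTop (𝓝 xstar) ∧
      ((∀ k, ∃ sC, t.IsCauchyStep f k sC ∧ t.model f k (t.s k) ≤ t.model f k sC) →
        (∀ᶠ k in atTop, t.VerySuccessful f p k) ∧ ARC.QQuadraticConv t.x xstar)) := by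

  have hL : 0 ≤ L := by
    have h1 := (norm_nonneg _).trans (hLip 0 1 (by simp))
    rw [mul_one] at h1
    exact nonneg_of_mul_nonneg_left h1 (norm_pos_iff.mpr (hrun.step_ne_zero 0))
  have hD : 0 ≤ (κB + 1) / (1 - p.θ) := by
    have h1 := (norm_nonneg _).trans (hκB 0)
    have h2 := p.θ_lt
    exact div_nonneg (by linarith) (by linarith)
  have hres : ∀ k, ‖t.s k‖ < 1 → ‖∇ (t.model f k) (t.s k)‖ ≤
      (κB + 1) / (1 - p.θ) * (1 + t.σ k) * ‖t.s k‖ ^ 2 := fun k =>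
    hrun.norm_gradient_model_le hκB (hstep.imp_right And.left)
  obtain ⟨c, hc, hgrad⟩ := hrun.exists_norm_gradient_add_le hf hL hLip hκB hD hres
  obtain ⟨S, hS⟩ := hrun.exists_σ_le hf hlow hL hLip hκB hc hgrad
  have hinf : ∃ᶠ k in atTop, t.Successful f p k :=
    hφ.tendsto_atTop.frequently (Eventually.of_forall hsucc).frequently
  have hg := hrun.tendsto_gradient hlow hinf hκB hS
  have hflag := hrun.eventually_flag_eq_false hlow hinf
  have hHB := hrun.tendsto_hessian_sub hflag hg
  -- `B_k` follows the Hessian along any subsequence of iterates that converges to `x*`.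
  have hB_tendsto : ∀ {ψ : ℕ → ℕ}, Tendsto ψ atTop atTop →
      Tendsto (fun i => t.x (ψ i)) atTop (𝓝 xstar) →
      Tendsto (fun i => t.B (ψ i)) atTop (𝓝 (ARC.hessian f xstar)) := fun {ψ} hψ hx => by
    have h1 := ((ARC.continuous_hessian hf).tendsto xstar).comp hx
    have h2 := h1.sub ((tendsto_zero_iff_norm_tendsto_zero.mpr hHB).comp hψ)
    simpa [Function.comp_def] using h2
  have hBφ := hB_tendsto hφ.tendsto_atTop hconv
  have hcrit := hrun.secondOrderCritical hf hg hφ.tendsto_atTop hconv hBφ (by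
    filter_upwards [hpos] with i hi v
    rcases eq_or_ne v 0 with rfl | hv
    · simp
    · exact (hi v hv).le)
  refine ⟨hcrit, ?_⟩
  rintro ⟨lam, hlam, hunif⟩
  have hH : ∀ v : ARC.Vec n, lam * ‖v‖ ^ 2 ≤ ⟪v, ARC.hessian f xstar v⟫ := fun v =>
    ge_of_tendsto (ARC.tendsto_inner_apply hBφ v v) (hunif.mono fun i hi => hi v)
  have hlb := ARC.eventually_le_norm_gradient hf hcrit.1 hlam hH
  have hx : Tendsto t.x atTop (𝓝 xstar) :=
    ARC.tendsto_of_mapClusterPt_of_le_norm (half_pos hlam)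
      (hconv.mapClusterPt.of_comp hφ.tendsto_atTop) hlb hg (hrun.tendsto_x_succ_sub hlow)
  refine ⟨hx, fun _ => ?_⟩
  have hB : ∀ᶠ k in atTop, ∀ v, lam / 2 * ‖v‖ ^ 2 ≤ ⟪v, t.B k v⟫ := by
    have h1 := (hB_tendsto tendsto_id hx).const_sub (ARC.hessian f xstar)
    rw [sub_self] at h1
    have h2 := h1.norm.eventually_le_const (u := lam / 2) (by rw [norm_zero]; positivity)
    filter_upwards [h2] with k hk using ARC.forall_half_mul_norm_sq_le hH hk
  have hs : Tendsto (fun k => ‖t.s k‖) atTop (𝓝 0) := by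
    have h1 : Tendsto (fun k => 2 / (lam / 2) * ‖∇ f (t.x k)‖) atTop (𝓝 0) := by
      simpa only [norm_zero, mul_zero] using hg.norm.const_mul (2 / (lam / 2))
    refine squeeze_zero' (Eventually.of_forall fun _ => norm_nonneg _) ?_ h1
    filter_upwards [hB] with k hk
    rw [div_mul_eq_mul_div, le_div_iff₀ (half_pos hlam), mul_comm]
    exact hrun.norm_step_le hk
  have hs1 : ∀ᶠ k in atTop, ‖t.s k‖ < 1 := hs.eventually_lt_const one_pos
  have hvery := hrun.eventually_verySuccessful hf hL hLip hflag hHB (half_pos hlam) hB hs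
    (R := (κB + 1) / (1 - p.θ) * (1 + S)) (by
      filter_upwards [hs1] with k hk
      refine (hres k hk).trans ?_
      gcongr
      exact hS k)
  exact ⟨hvery, hrun.qQuadraticConv hf hc hS hgrad hx hcrit.1 (half_pos hlam) (half_pos hlam) hlb
    hB hs1 (hvery.mono fun k hk => ⟨hk.1, p.η₁_le.trans hk.2⟩)⟩
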